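/- Let $a>0$ and let Gödel spacetime $\mathscr M$ be $\mathbb R^4$ with global coordinates $(x_0,x_1,x_2,x_3)$ and the Lorentzian metric of signature $(+,-,-,-)$ $$ds^2=a^2\Bigl[dx_0^2-dx_1^2+\tfrac12 e^{2x_1}\,dx_2^2-dx_3^2+2e^{x_1}\,dx_0\,dx_2\Bigr].$$ A tangent vector $v$ is timelike if $\langle v,v\rangle>0$, and a closed timelike curve is a smooth periodic curve $\gamma:\mathbb R\to\mathscr M$ of some period $T>0$ whose tangent vector $\dot\gamma(s)$ is timelike for every $s$. Then for any two points $m_1,m_2\in\mathscr M$ there is a closed timelike curve that passes through both $m_1$ and $m_2$. -/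

import Mathlib

open scoped ContDiff Matrix

/-- The underlying manifold of Gödel spacetime: `ℝ⁴` with its global coordinates
`(x₀, x₁, x₂, x₃)`. The tangent space at each point is identified with `ℝ⁴`. -/
abbrev GodelSpacetime : Type := Fin 4 → ℝ

/-- The matrix `g_{μν}` of Gödel's metric of scale `a` (signature `(+,-,-,-)`) at the point `x`. -/
noncomputable def godelMetric (a : ℝ) (x : GodelSpacetime) : Matrix (Fin 4) (Fin 4) ℝ :=
  a ^ 2 • !![1, 0, Real.exp (x 1), 0;
             0, -1, 0, 0;
             Real.exp (x 1), 0, Real.exp (2 * x 1) / 2, 0;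
             0, 0, 0, -1]

/-- The scalar product `g_{μν}(x) v^μ w^ν` of two tangent vectors at `x`. -/
noncomputable def godelInner (a : ℝ) (x : GodelSpacetime) (v w : Fin 4 → ℝ) : ℝ :=
  v ⬝ᵥ (godelMetric a x *ᵥ w)

/-- A tangent vector `v` at `x` is timelike if `⟨v, v⟩ > 0` (signature `(+,-,-,-)`). -/
def IsGodelTimelike (a : ℝ) (x : GodelSpacetime) (v : Fin 4 → ℝ) : Prop :=
  0 < godelInner a x v v

/-- A closed timelike curve: a smooth curve `γ`, periodic with period `T > 0`, whose tangent
vector is timelike at every value of the parameter. (Smoothness and periodicity make the curve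
close up smoothly, so no corner and no reversal of time direction can occur.) -/
structure IsClosedTimelikeCurve (a : ℝ) (γ : ℝ → GodelSpacetime) (T : ℝ) : Prop where
  period_pos : 0 < T
  smooth : ContDiff ℝ ∞ γ
  periodic : Function.Periodic γ T
  timelike : ∀ s : ℝ, IsGodelTimelike a (γ s) (deriv γ s)

/-!
Gödel's metric is left invariant for a group structure on `ℝ⁴`, so a closed timelike curve `c`
through the origin can be translated to start at any point. Displace it slowly along a closed curve
`b` from `m₁` to `m₂` and back, while running `N` times faster around it: `γ s = b s · c (N s)`. Its
velocity is `N` times the translated velocity of `c`, plus an error that stays bounded as `N` grows.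
Since timelike vectors form an open cone and everything is periodic, compactness makes `γ` timelike
for all large `N`.

Closed timelike curves through the origin exist because the surfaces of constant `x₃` fibre over the
hyperbolic plane with coordinates `(x₁, x₂)`: over a large enough circle, the holonomy of
`dx₀ + e^{x₁} dx₂`, which is proportional to the enclosed area, exceeds the length.
-/

open Filter Function Real
open scoped Topology

theorem isCompact_range_of_periodic_prod {X : Type*} [TopologicalSpace X] {f : ℝ × ℝ → X}
    (hf : Continuous f) {T₁ T₂ : ℝ} (hT₁ : T₁ ≠ 0) (hT₂ : T₂ ≠ 0)
    (hper₁ : Periodic f (T₁, 0)) (hper₂ : Periodic f (0, T₂)) : IsCompact (Set.range f) := by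
  suffices h : f '' (Set.uIcc 0 T₁ ×ˢ Set.uIcc 0 T₂) = Set.range f from
    h ▸ (isCompact_uIcc.prod isCompact_uIcc).image hf
  refine (Set.image_subset_range _ _).antisymm ?_
  rintro _ ⟨⟨s, t⟩, rfl⟩
  have hs : Periodic (fun s ↦ f (s, t)) T₁ := fun s ↦ by simpa using hper₁ (s, t)
  obtain ⟨s', hs', hss'⟩ : f (s, t) ∈ (fun s ↦ f (s, t)) '' Set.uIcc 0 (0 + T₁) :=
    hs.image_uIcc hT₁ 0 ▸ Set.mem_range_self s
  have ht : Periodic (fun t ↦ f (s', t)) T₂ := fun t ↦ by simpa using hper₂ (s', t)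
  obtain ⟨t', ht', htt'⟩ : f (s', t) ∈ (fun t ↦ f (s', t)) '' Set.uIcc 0 (0 + T₂) :=
    ht.image_uIcc hT₂ 0 ▸ Set.mem_range_self t
  rw [zero_add] at hs' ht'
  exact ⟨(s', t'), ⟨hs', ht'⟩, htt'.trans hss'⟩

theorem periodic_fderiv {𝕜 V W : Type*} [NontriviallyNormedField 𝕜] [NormedAddCommGroup V]
    [NormedSpace 𝕜 V] [NormedAddCommGroup W] [NormedSpace 𝕜 W] {f : V → W} {c : V}
    (hf : Periodic f c) : Periodic (fderiv 𝕜 f) c := fun x ↦ by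
  rw [← fderiv_comp_add_right, hf.funext]

section ConeField

variable {E : Type*} [NormedAddCommGroup E] [NormedSpace ℝ E]

theorem eventually_velocity_winding_mem {U : Set (E × E)} (hU : IsOpen U)
    (hcone : ∀ ⦃x v : E⦄ ⦃r : ℝ⦄, 0 < r → (x, v) ∈ U → (x, r • v) ∈ U)
    {F : ℝ × ℝ → E} (hF : ContDiff ℝ 1 F) {T₁ T₂ : ℝ} (hT₁ : T₁ ≠ 0) (hT₂ : T₂ ≠ 0)
    (hper₁ : Periodic F (T₁, 0)) (hper₂ : Periodic F (0, T₂))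
    (hmem : ∀ s t, (F (s, t), deriv (fun t ↦ F (s, t)) t) ∈ U) :
    ∀ᶠ N : ℝ in atTop, ∀ s, (F (s, N * s), deriv (fun s ↦ F (s, N * s)) s) ∈ U := by
  have hFd (z : ℝ × ℝ) : HasFDerivAt F (fderiv ℝ F z) z :=
    (hF.differentiable one_ne_zero z).hasFDerivAt
  let jet (z : ℝ × ℝ) : E × (ℝ × ℝ →L[ℝ] E) := (F z, fderiv ℝ F z)
  have hjet : IsCompact (Set.range jet) :=
    isCompact_range_of_periodic_prod (hF.continuous.prodMk (hF.continuous_fderiv one_ne_zero))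
      hT₁ hT₂ (fun z ↦ Prod.ext (hper₁ z) (periodic_fderiv hper₁ z))
      (fun z ↦ Prod.ext (hper₂ z) (periodic_fderiv hper₂ z))
  have hjet_mem : ∀ j ∈ Set.range jet, (j.1, j.2 (0, 1)) ∈ U := by
    rintro _ ⟨⟨s, t⟩, rfl⟩
    have h := (hFd (s, t)).comp_hasDerivAt t ((hasDerivAt_const t s).prodMk (hasDerivAt_id t))
    exact h.deriv ▸ hmem s t
  have hnear : ∀ᶠ ε : ℝ in 𝓝 0, ∀ j ∈ Set.range jet, (j.1, j.2 (ε, 1)) ∈ U := by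
    refine hjet.eventually_forall_of_forall_eventually fun j hj ↦ ?_
    have hcont : Continuous fun y : ℝ × (E × (ℝ × ℝ →L[ℝ] E)) ↦ (y.2.1, y.2.2 (y.1, 1)) := by
      fun_prop
    exact hcont.continuousAt.eventually (hU.mem_nhds (hjet_mem j hj))
  filter_upwards [tendsto_inv_atTop_zero.eventually hnear, eventually_gt_atTop 0] with N hN hN₀ s
  have hderiv : HasDerivAt (fun s ↦ F (s, N * s)) (N • fderiv ℝ F (s, N * s) (N⁻¹, 1)) s := by
    have h := (hFd (s, N * s)).comp_hasDerivAt s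
      ((hasDerivAt_id s).prodMk ((hasDerivAt_id s).const_mul N))
    refine h.congr_deriv ?_
    rw [← map_smul, Prod.smul_mk, smul_eq_mul, smul_eq_mul, mul_inv_cancel₀ hN₀.ne']
  rw [hderiv.deriv]
  exact hcone hN₀ (hN _ ⟨(s, N * s), rfl⟩)

theorem exists_contDiff_periodic_through (p q : E) {T : ℝ} (hT : T ≠ 0) :
    ∃ b : ℝ → E, ContDiff ℝ ∞ b ∧ Periodic b (2 * T) ∧ b 0 = p ∧ b T = q := by
  refine ⟨fun s ↦ AffineMap.lineMap p q ((1 - cos (π * s / T)) / 2), ?_, fun s ↦ ?_, ?_, ?_⟩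
  · simp only [AffineMap.lineMap_apply_module']
    fun_prop
  · have hangle : π * (s + 2 * T) / T = π * s / T + 2 * π := by field_simp
    simp only [hangle, cos_add_two_pi]
  · simp
  · simp [hT]

end ConeField

theorem godelInner_eq (a : ℝ) (x : GodelSpacetime) (v w : Fin 4 → ℝ) :
    godelInner a x v w = a ^ 2 * ((v 0 + exp (x 1) * v 2) * (w 0 + exp (x 1) * w 2) - v 1 * w 1
      - exp (x 1) * v 2 * (exp (x 1) * w 2) / 2 - v 3 * w 3) := by
  have hexp : exp (2 * x 1) = exp (x 1) ^ 2 := by rw [← exp_nat_mul, Nat.cast_ofNat]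
  simp only [godelInner, godelMetric, hexp, dotProduct, Matrix.mulVec, Fin.sum_univ_four,
    Matrix.smul_apply, Matrix.of_apply, Matrix.cons_val, smul_eq_mul]
  ring

theorem isOpen_setOf_isGodelTimelike (a : ℝ) :
    IsOpen {z : GodelSpacetime × (Fin 4 → ℝ) | IsGodelTimelike a z.1 z.2} := by
  simp only [IsGodelTimelike, godelInner_eq]
  exact isOpen_lt (by fun_prop) (by fun_prop)

theorem IsGodelTimelike.smul {a : ℝ} {x : GodelSpacetime} {v : Fin 4 → ℝ}
    (h : IsGodelTimelike a x v) {r : ℝ} (hr : r ≠ 0) : IsGodelTimelike a x (r • v) := by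
  have hsq : godelInner a x (r • v) (r • v) = r ^ 2 * godelInner a x v v := by
    simp only [godelInner, Matrix.mulVec_smul, smul_dotProduct, dotProduct_smul, smul_eq_mul]
    ring
  rw [IsGodelTimelike, hsq]
  exact mul_pos (by positivity) h

/-- The diagonal of the (constant) derivative of the left translation by `p`; it acts on tangent
vectors by the coordinatewise product of `Fin 4 → ℝ`. -/
noncomputable def godelTranslateScale (p : GodelSpacetime) : Fin 4 → ℝ :=
  ![1, 1, exp (-p 1), 1]

/-- The left translation by `p` for the group structure on `ℝ⁴` that makes Gödel's metric left
invariant. -/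
noncomputable def godelTranslate (p x : GodelSpacetime) : GodelSpacetime :=
  p + godelTranslateScale p * x

@[simp]
theorem godelTranslate_zero (p : GodelSpacetime) : godelTranslate p 0 = p := by
  simp [godelTranslate]

theorem contDiff_godelTranslateScale : ContDiff ℝ ∞ godelTranslateScale := by
  rw [contDiff_pi]
  intro i
  fin_cases i
  · exact contDiff_const
  · exact contDiff_const
  · exact (contDiff_apply ℝ ℝ (1 : Fin 4)).neg.exp
  · exact contDiff_const

theorem contDiff_godelTranslate :
    ContDiff ℝ ∞ fun z : GodelSpacetime × GodelSpacetime ↦ godelTranslate z.1 z.2 :=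
  contDiff_fst.add ((contDiff_godelTranslateScale.comp contDiff_fst).mul contDiff_snd)

theorem hasDerivAt_godelTranslate {c : ℝ → GodelSpacetime} {v : Fin 4 → ℝ} {t : ℝ}
    (hc : HasDerivAt c v t) (p : GodelSpacetime) :
    HasDerivAt (fun t ↦ godelTranslate p (c t)) (godelTranslateScale p * v) t :=
  (hc.const_mul _).const_add p

theorem godelInner_godelTranslate (a : ℝ) (p x : GodelSpacetime) (v w : Fin 4 → ℝ) :
    godelInner a (godelTranslate p x) (godelTranslateScale p * v) (godelTranslateScale p * w) =
      godelInner a x v w := by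
  have hframe (u : ℝ) : exp (godelTranslate p x 1) * (exp (-p 1) * u) = exp (x 1) * u := by
    rw [← mul_assoc, ← exp_add]
    simp [godelTranslate, godelTranslateScale]
  simp [godelInner_eq, godelTranslateScale, hframe]

theorem IsClosedTimelikeCurve.exists_through_of_apply_zero {a T : ℝ} {c : ℝ → GodelSpacetime}
    (hc : IsClosedTimelikeCurve a c T) (hc₀ : c 0 = 0) (p q : GodelSpacetime) :
    ∃ γ, IsClosedTimelikeCurve a γ (2 * T) ∧ γ 0 = p ∧ γ T = q := by
  have hT := hc.period_pos
  obtain ⟨b, hb, hb_per, hb₀, hbT⟩ := exists_contDiff_periodic_through p q hT.ne'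
  let F (z : ℝ × ℝ) : GodelSpacetime := godelTranslate (b z.1) (c z.2)
  have hF : ContDiff ℝ ∞ F :=
    contDiff_godelTranslate.comp ((hb.comp contDiff_fst).prodMk (hc.smooth.comp contDiff_snd))
  have hper₁ : Periodic F (2 * T, 0) := fun z ↦ by simp [F, hb_per z.1]
  have hper₂ : Periodic F (0, T) := fun z ↦ by simp [F, hc.periodic z.2]
  have htimelike (s t : ℝ) : IsGodelTimelike a (F (s, t)) (deriv (fun t ↦ F (s, t)) t) := by
    have hct := (hc.smooth.differentiable (by simp) t).hasDerivAt
    rw [(hasDerivAt_godelTranslate hct (b s)).deriv, IsGodelTimelike, godelInner_godelTranslate]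
    exact hc.timelike t
  obtain ⟨n, hn⟩ := (tendsto_natCast_atTop_atTop.eventually
    (eventually_velocity_winding_mem (isOpen_setOf_isGodelTimelike a)
      (fun _ _ _ hr h ↦ h.smul hr.ne') (hF.of_le (by simp)) (by positivity) hT.ne'
      hper₁ hper₂ htimelike)).exists
  have hc_mul (m : ℕ) (s : ℝ) : c (n * (s + m * T)) = c (n * s) := by
    rw [mul_add, ← mul_assoc, ← Nat.cast_mul]
    exact hc.periodic.nat_mul (n * m) (n * s)
  refine ⟨fun s ↦ F (s, n * s), ⟨by positivity, by fun_prop, fun s ↦ ?_, hn⟩, ?_, ?_⟩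
  · simpa [F, hb_per s] using congrArg (godelTranslate (b s)) (hc_mul 2 s)
  · simp [F, hb₀, hc₀]
  · simpa [F, hbT, hc₀] using congrArg (godelTranslate q) (hc_mul 1 0)

section Circle

variable {k : ℝ}

theorem one_add_mul_cos_pos (hk : |k| < 1) (t : ℝ) : 0 < 1 + k * cos t := by
  have h : |k * cos t| < 1 := by
    rw [abs_mul]
    exact mul_lt_one_of_nonneg_of_lt_one_left (abs_nonneg k) hk (abs_cos_le_one t)
  linarith [neg_lt_of_abs_lt h]

theorem one_add_sq_add_two_mul_cos_pos (hk : |k| < 1) (t : ℝ) :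
    0 < 1 + k ^ 2 + 2 * k * cos t := by
  have h : 1 + k ^ 2 + 2 * k * cos t = (1 + k * cos t) ^ 2 + (k * sin t) ^ 2 := by
    linear_combination (-k ^ 2) * sin_sq_add_cos_sq t
  rw [h]
  have hre := one_add_mul_cos_pos hk t
  positivity

theorem hasDerivAt_arctan_mul_sin_div (hk : |k| < 1) (t : ℝ) :
    HasDerivAt (fun t ↦ arctan (k * sin t / (1 + k * cos t)))
      ((k ^ 2 + k * cos t) / (1 + k ^ 2 + 2 * k * cos t)) t := by
  have hpos := one_add_mul_cos_pos hk t
  refine (((hasDerivAt_sin t).const_mul k).div (((hasDerivAt_cos t).const_mul k).const_add 1)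
    hpos.ne').arctan.congr_deriv ?_
  have hden : 1 + (k * sin t / (1 + k * cos t)) ^ 2 =
      (1 + k ^ 2 + 2 * k * cos t) / (1 + k * cos t) ^ 2 := by
    field_simp
    linear_combination k ^ 2 * sin_sq_add_cos_sq t
  have hnum : k * cos t * (1 + k * cos t) - k * sin t * (k * -sin t) = k ^ 2 + k * cos t := by
    linear_combination k ^ 2 * sin_sq_add_cos_sq t
  simp only [Pi.div_apply, hden, hnum]
  field_simp

/-- For `|k| < 1`, a closed curve through the origin of Gödel spacetime lying over the hyperbolic
circle of radius `2 * artanh |k|`, in the half-plane model with height `exp (-x₁)`. The arctangent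
is the argument of `1 + k * exp (t * I)`, and its multiple `2 * √2` is chosen so that the `cos t`
terms cancel in the numerator of the time component `x₀' + exp x₁ * x₂'` of the velocity. The curve
is timelike exactly for `1 / 2 < k ^ 2`, that is, when the circle is large enough. -/
noncomputable def godelCircle (k t : ℝ) : GodelSpacetime :=
  ![-(2 * √2) * arctan (k * sin t / (1 + k * cos t)),
    -log ((1 + k ^ 2 + 2 * k * cos t) / (1 + k) ^ 2),
    2 * √2 * k / (1 + k) ^ 2 * sin t,
    0]

theorem godelCircle_zero (hk : 1 + k ≠ 0) : godelCircle k 0 = 0 := by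
  have hratio : (1 + k ^ 2 + 2 * k) / (1 + k) ^ 2 = 1 := by field_simp; ring
  ext i
  fin_cases i <;> simp [godelCircle, hratio]

theorem periodic_godelCircle (k : ℝ) : Periodic (godelCircle k) (2 * π) := fun t ↦ by
  simp only [godelCircle, sin_add_two_pi, cos_add_two_pi]

theorem contDiff_godelCircle (hk : |k| < 1) : ContDiff ℝ ∞ (godelCircle k) := by
  have hk₁ : 1 + k ≠ 0 := by linarith [neg_lt_of_abs_lt hk]
  have hre (t : ℝ) : 1 + k * cos t ≠ 0 := (one_add_mul_cos_pos hk t).ne'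
  have hnorm (t : ℝ) : (1 + k ^ 2 + 2 * k * cos t) / (1 + k) ^ 2 ≠ 0 :=
    div_ne_zero (one_add_sq_add_two_mul_cos_pos hk t).ne' (pow_ne_zero 2 hk₁)
  have harctan : ContDiff ℝ ∞ fun t ↦ arctan (k * sin t / (1 + k * cos t)) :=
    ContDiff.arctan (by fun_prop (disch := assumption))
  rw [contDiff_pi]
  intro i
  fin_cases i
  · exact contDiff_const.mul harctan
  · exact ContDiff.neg (ContDiff.log (by fun_prop) hnorm)
  · exact contDiff_const.mul contDiff_sin
  · exact contDiff_const

theorem hasDerivAt_godelCircle (hk : |k| < 1) (t : ℝ) :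
    HasDerivAt (godelCircle k)
      ![-(2 * √2) * ((k ^ 2 + k * cos t) / (1 + k ^ 2 + 2 * k * cos t)),
        2 * k * sin t / (1 + k ^ 2 + 2 * k * cos t),
        2 * √2 * k / (1 + k) ^ 2 * cos t,
        0] t := by
  have hk₁ : 1 + k ≠ 0 := by linarith [neg_lt_of_abs_lt hk]
  have hnorm := (one_add_sq_add_two_mul_cos_pos hk t).ne'
  rw [hasDerivAt_pi]
  intro i
  fin_cases i
  · exact (hasDerivAt_arctan_mul_sin_div hk t).const_mul _
  · refine (((((hasDerivAt_cos t).const_mul (2 * k)).const_add (1 + k ^ 2)).div_const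
      ((1 + k) ^ 2)).log (div_ne_zero hnorm (pow_ne_zero 2 hk₁))).neg.congr_deriv ?_
    simp only [mul_neg, neg_mul, Fin.mk_one, Matrix.cons_val_one, Matrix.cons_val_zero]
    field_simp
  · exact (hasDerivAt_sin t).const_mul _
  · exact hasDerivAt_const t _

theorem exp_godelCircle_one (hk : |k| < 1) (t : ℝ) :
    exp (godelCircle k t 1) = (1 + k) ^ 2 / (1 + k ^ 2 + 2 * k * cos t) := by
  have hk₁ : 0 < 1 + k := by linarith [neg_lt_of_abs_lt hk]
  have hnorm := one_add_sq_add_two_mul_cos_pos hk t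
  simp only [godelCircle, Matrix.cons_val]
  rw [exp_neg, exp_log (by positivity), inv_div]

theorem godelInner_deriv_godelCircle (a : ℝ) (hk : |k| < 1) (t : ℝ) :
    godelInner a (godelCircle k t) (deriv (godelCircle k) t) (deriv (godelCircle k) t) =
      4 * a ^ 2 * k ^ 2 * (2 * k ^ 2 - 1) / (1 + k ^ 2 + 2 * k * cos t) ^ 2 := by
  have hk₁ : 1 + k ≠ 0 := by linarith [neg_lt_of_abs_lt hk]
  have hnorm := (one_add_sq_add_two_mul_cos_pos hk t).ne'
  rw [(hasDerivAt_godelCircle hk t).deriv, godelInner_eq, exp_godelCircle_one hk]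
  simp only [Matrix.cons_val]
  have hsqrt : √2 ^ 2 = 2 := sq_sqrt zero_le_two
  field_simp
  simp only [hsqrt]
  linear_combination (-4 * k ^ 2 * a ^ 2) * sin_sq_add_cos_sq t

theorem isClosedTimelikeCurve_godelCircle {a : ℝ} (ha : a ≠ 0) (hk : |k| < 1)
    (hk_sq : 1 / 2 < k ^ 2) : IsClosedTimelikeCurve a (godelCircle k) (2 * π) where
  period_pos := two_pi_pos
  smooth := contDiff_godelCircle hk
  periodic := periodic_godelCircle k
  timelike t := by
    have hnorm := one_add_sq_add_two_mul_cos_pos hk t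
    have hsub : 0 < 2 * k ^ 2 - 1 := by linarith
    have hk₀ : 0 < k ^ 2 := by linarith
    rw [IsGodelTimelike, godelInner_deriv_godelCircle a hk t]
    exact div_pos (mul_pos (mul_pos (by positivity) hk₀) hsub) (pow_pos hnorm 2)

end Circle

theorem mainTheorem2 (a : ℝ) (ha : 0 < a) (m₁ m₂ : GodelSpacetime) :
    ∃ (γ : ℝ → GodelSpacetime) (T : ℝ), IsClosedTimelikeCurve a γ T ∧
      (∃ s₁ : ℝ, γ s₁ = m₁) ∧ (∃ s₂ : ℝ, γ s₂ = m₂) := by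
  have hcircle : IsClosedTimelikeCurve a (godelCircle (3 / 4)) (2 * π) :=
    isClosedTimelikeCurve_godelCircle ha.ne' (by norm_num [abs_lt]) (by norm_num)
  obtain ⟨γ, hγ, hγ₁, hγ₂⟩ :=
    hcircle.exists_through_of_apply_zero (godelCircle_zero (by norm_num)) m₁ m₂
  exact ⟨γ, 2 * (2 * π), hγ, ⟨0, hγ₁⟩, ⟨2 * π, hγ₂⟩⟩
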